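/- Let $(\mathbb{K},|\cdot|)$ be an algebraically closed normed field, let $f\in\mathbb{K}[z]$ be a polynomial of degree $n\ge 2$ with leading coefficient $a_0$, let $N\ge 1$ be an integer, let $1\le p\le\infty$, let $q$ be the conjugate exponent of $p$ (that is, $1/p+1/q=1$), and put $a=(n-1)^{1/q}$. For $x\in\mathbb{K}^n$ with distinct components put $$W_i(x)=\frac{f(x_i)}{a_0\prod_{j\ne i}(x_i-x_j)},\qquad d_i(x)=\min_{j\ne i}|x_i-x_j|,\qquad E_f(x)=\left\|\left(\frac{|W_1(x)|}{d_1(x)},\dots,\frac{|W_n(x)|}{d_n(x)}\right)\right\|_p .$$ Define $D_0=\mathbb{K}^n$, $T^{(0)}(x)=x$ and, recursively for $M\ge 0$, $$D_{M+1}=\{x\in D_M:\ x_i\ne T^{(M)}_j(x)\ \text{for all } i\ne j\},\qquad T^{(M+1)}_i(x)=x_i-\frac{f(x_i)}{a_0\prod_{j\ne i}\bigl(x_i-T^{(M)}_j(x)\bigr)}\quad (x\in D_{M+1}).$$ Further put $$\alpha(t)=\frac{2}{1-(a-1)t+\sqrt{(1-(a-1)t)^2-4t}},\qquad \Psi(t)=(1+2t)\Bigl(1+\frac{t}{(n-1)^{1/p}}\Bigr)^{n-1},\qquad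 \Omega(t)=\Psi(t\,\alpha(t)).$$ Suppose $x^{(0)}\in\mathbb{K}^n$ has distinct components and $$E_f(x^{(0)})\le\frac{2}{5a+6}.$$ Then $f$ has only simple zeros in $\mathbb{K}$; the $N$-th Weierstrass-type iteration $x^{(k+1)}=T^{(N)}(x^{(k)})$, $k=0,1,2,\dots$, is well-defined, i.e. $x^{(k)}\in D_N$ for all $k\ge 0$; and there is a root-vector $\xi\in\mathbb{K}^n$ of $f$ (that is, $f(z)=a_0\prod_{i=1}^n(z-\xi_i)$ for all $z\in\mathbb{K}$) such that $x^{(k)}\to\xi$ with order of convergence $N+1$, i.e. there is a constant $C>0$ with $\|x^{(k+1)}-\xi\|_p\le C\,\|x^{(k)}-\xi\|_p^{\,N+1}$ for all $k\ge 0$, and such that the error estimate $$|x^{(k)}_i-\xi_i|\le\alpha\bigl(E_f(x^{(k)})\bigr)\,|W_i(x^{(k)})|\qquad(i=1,\dots,n)$$ holds for every $k\ge 0$ with $E_f(x^{(k)})\le 1/(1+\sqrt a)^2$ and $\Omega(E_f(x^{(k)}))<2$. -/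

import Mathlib

open Filter
open scoped Polynomial Topology ENNReal

noncomputable section

namespace WeierstrassType

variable {K : Type*} [NormedField K] {n : ℕ}

/-- `ξ` is a root-vector of `f`: there is `a₀` with `f(z) = a₀ ∏ᵢ (z - ξᵢ)` for all `z`. -/
def IsRootVector (f : K[X]) (ξ : Fin n → K) : Prop :=
  ∃ a₀ : K, ∀ z : K, f.eval z = a₀ * ∏ i, (z - ξ i)

/-- All zeros of `f` in `K` are simple. -/
def OnlySimpleZeros (f : K[X]) : Prop :=
  ∀ z : K, f.IsRoot z → f.rootMultiplicity z = 1

/-- The `p`-norm on `Eⁿ` for `1 ≤ p ≤ ∞` (the maximum norm for `p = ∞`). -/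
def pNorm {E : Type*} [NormedAddCommGroup E] (p : ℝ≥0∞) (v : Fin n → E) : ℝ :=
  ‖(WithLp.toLp p v : PiLp p (fun _ : Fin n => E))‖

/-- `d_i(x) = min_{j ≠ i} |x_i - x_j|` (used for `n ≥ 2`, where the index set is nonempty). -/
def minDist (x : Fin n → K) (i : Fin n) : ℝ :=
  ⨅ j : {j : Fin n // j ≠ i}, ‖x i - x j‖

/-- The Weierstrass correction `W_i(x) = f(x_i) / (a₀ ∏_{j ≠ i} (x_i - x_j))`, with `a₀` the
leading coefficient of `f`; meaningful for `x` with distinct components. -/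
def correction (f : K[X]) (x : Fin n → K) (i : Fin n) : K :=
  f.eval (x i) / (f.leadingCoeff * ∏ j ∈ Finset.univ.erase i, (x i - x j))

/-- The function of initial conditions `E_f(x) = ‖W_f(x) / d(x)‖_p`. -/
def initFun (p : ℝ≥0∞) (f : K[X]) (x : Fin n → K) : ℝ :=
  pNorm p (fun i => ‖correction f x i‖ / minDist x i)

/-- The relation `x # y`: `x_i ≠ y_j` whenever `i ≠ j`. -/
def Sharp (x y : Fin n → K) : Prop :=
  ∀ i j : Fin n, i ≠ j → x i ≠ y j

/-- The Weierstrass-type iteration functions: `T⁽⁰⁾(x) = x` and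
`T⁽ᴺ⁺¹⁾_i(x) = x_i - f(x_i) / (a₀ ∏_{j ≠ i} (x_i - T⁽ᴺ⁾_j(x)))`, with `a₀` the leading coefficient
of `f`; meaningful on the domain `iterDomain f N`. -/
def iterFun (f : K[X]) : ℕ → (Fin n → K) → (Fin n → K)
  | 0, x => x
  | N + 1, x => fun i =>
      x i - f.eval (x i) /
        (f.leadingCoeff * ∏ j ∈ Finset.univ.erase i, (x i - iterFun f N x j))

/-- The domains `D_0 = Kⁿ`, `D_{N+1} = {x ∈ D_N | x # T⁽ᴺ⁾(x)}`. -/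
def iterDomain (f : K[X]) : ℕ → Set (Fin n → K)
  | 0 => Set.univ
  | N + 1 => {x | x ∈ iterDomain f N ∧ Sharp x (iterFun f N x)}

/-- The `N`-th Weierstrass-type iteration `x⁽ᵏ⁺¹⁾ = T⁽ᴺ⁾(x⁽ᵏ⁾)` started at `x⁽⁰⁾ = x₀`. -/
def iterSeq (f : K[X]) (N : ℕ) (x₀ : Fin n → K) : ℕ → Fin n → K
  | 0 => x₀
  | k + 1 => iterFun f N (iterSeq f N x₀ k)

/-- The iteration started at `x₀` is well-defined: every iterate lies in the domain `D_N`. -/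
def IterWellDefined (f : K[X]) (N : ℕ) (x₀ : Fin n → K) : Prop :=
  ∀ k : ℕ, iterSeq f N x₀ k ∈ iterDomain f N

/-- The sequence `x` converges to `ξ` with order of convergence (at least) `r`. -/
def ConvergesWithOrder (p : ℝ≥0∞) (r : ℕ) (x : ℕ → Fin n → K) (ξ : Fin n → K) : Prop :=
  Tendsto x atTop (𝓝 ξ) ∧
    ∃ C : ℝ, 0 < C ∧ ∀ k : ℕ, pNorm p (x (k + 1) - ξ) ≤ C * pNorm p (x k - ξ) ^ r

/-- `a = (n - 1)^{1/q}`; for `q = ∞` the exponent is `0`. -/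
def aConst (n : ℕ) (q : ℝ≥0∞) : ℝ := ((n : ℝ) - 1) ^ (q⁻¹).toReal

/-- `α(t) = 2 / (1 - (a - 1) t + √((1 - (a - 1) t)² - 4 t))`. -/
def alpha (a t : ℝ) : ℝ :=
  2 / (1 - (a - 1) * t + √((1 - (a - 1) * t) ^ 2 - 4 * t))

/-- `Ψ(t) = (1 + 2 t) (1 + t / (n - 1)^{1/p})^{n - 1}`. -/
def Psi (n : ℕ) (p : ℝ≥0∞) (t : ℝ) : ℝ :=
  (1 + 2 * t) * (1 + t / ((n : ℝ) - 1) ^ (p⁻¹).toReal) ^ (n - 1)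

/-- `Ω(t) = Ψ(h(t))` with `h(t) = t α(t)`, where `a = (n - 1)^{1/q}`. -/
def Omega (n : ℕ) (p q : ℝ≥0∞) (t : ℝ) : ℝ :=
  Psi n p (t * alpha (aConst n q) t)

end WeierstrassType

end

noncomputable section

namespace WeierstrassType

variable {K : Type*} [NormedField K] {n : ℕ}

/-! ### Scalar estimates -/

/-! Lagrange interpolation at the components of `x` turns `f z = 0` near `x i` into the fixed-point
equation `z = x i - W_i / (1 + ∑_{j ≠ i} W_j / (z - x j))`. With `t = E_f(x)` and `h = t α(t)`, the
defining quadratic of `α` makes the ball of radius `α |W_i|` about `x i` invariant, and `Ψ(h) < 2`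
makes the map a contraction there and forces the resulting zeros to be distinct
(`exists_isRoot_near`, `exists_roots_of_initFun_le`). As `f` has degree `n`, these `n` zeros are all
of them and are simple. `K` need not be complete, so the zero is not a limit of the orbit: `f` tends
to `0` along the orbit and splits, hence cannot be zero-free on the ball.

Once the roots are known, the rest is a local analysis. `IsApprox` records relative errors `v`,
their bound `s` and a rate `b` with `(1 + 2s)(1 + b) < 2`. The error identity `step_sub_eq` shows
that a step contracts each error by `b`, and the separation of the components cannot shrink faster;
so the same `v`, `s`, `b` serve for all iterates. The same identity gains one power of the error
with each inner iteration, which gives order `N + 1`.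

What remains is scalar: `E_f ≤ 2 / (5a + 6)` must imply `Ω(E_f) < 2`. Through `(1 + x/m)^m ≤ exp x`
this becomes `(1 + 2H) exp(aH) < 2` for an explicit upper bound `H` of `h`
(`exists_bound_mul_alpha`). -/

theorem discr_nonneg_of_le {a t : ℝ} (ha : 1 ≤ a) (ht0 : 0 ≤ t)
    (ht : t ≤ 1 / (1 + √a) ^ 2) :
    0 < 1 - (a - 1) * t ∧ 4 * t ≤ (1 - (a - 1) * t) ^ 2 := by
  have hs : 1 ≤ √a := Real.one_le_sqrt.mpr ha
  have hsa : √a ^ 2 = a := Real.sq_sqrt (by linarith)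
  set s := √a
  have hu0 : 0 ≤ √t := Real.sqrt_nonneg t
  have hu : √t ^ 2 = t := Real.sq_sqrt ht0
  set u := √t
  have h1 : u * (1 + s) ≤ 1 := by
    have h2 : (u * (1 + s)) ^ 2 ≤ 1 ^ 2 := by
      rw [mul_pow, hu]
      rw [le_div_iff₀ (by positivity)] at ht
      linarith
    exact le_of_pow_le_pow_left₀ two_ne_zero zero_le_one h2
  -- With `u = √t` the hypothesis is `s u ≤ 1 - u`. Its square reads `a t ≤ 1 - 2u + t`, which is
  -- `h4`.
  have h3 : (s * u) ^ 2 ≤ (1 - u) ^ 2 := by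
    have : 0 ≤ s * u := by positivity
    exact pow_le_pow_left₀ this (by nlinarith) 2
  have h4 : 2 * u ≤ 1 - (a - 1) * t := by
    rw [← hsa, ← hu]; nlinarith
  refine ⟨?_, ?_⟩
  · rcases hu0.eq_or_lt with h | h
    · rw [← hu, ← h]; norm_num
    · linarith
  · rw [← hu] at h4 ⊢
    nlinarith

theorem alpha_spec {a t : ℝ} (hb : 0 < 1 - (a - 1) * t)
    (hD : 4 * t ≤ (1 - (a - 1) * t) ^ 2) :
    0 < alpha a t ∧
    (t * alpha a t) ^ 2 - (1 - (a - 1) * t) * (t * alpha a t) + t = 0 ∧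
    (1 - (a - 1) * t - t * alpha a t) * alpha a t = 1 ∧
    2 * (t * alpha a t) ≤ 1 - (a - 1) * t := by
  unfold alpha
  set b := 1 - (a - 1) * t
  have hr0 : 0 ≤ √(b ^ 2 - 4 * t) := Real.sqrt_nonneg _
  have hr : √(b ^ 2 - 4 * t) ^ 2 = b ^ 2 - 4 * t := Real.sq_sqrt (by linarith)
  set r := √(b ^ 2 - 4 * t)
  have hbr : 0 < b + r := by linarith
  have hh : t * (2 / (b + r)) = (b - r) / 2 := by
    field_simp
    nlinarith
  refine ⟨by positivity, ?_, ?_, ?_⟩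
  · rw [hh]; nlinarith
  · rw [hh]; field_simp; ring
  · rw [hh]; linarith

/-- `t α(t)` is the smaller root of the quadratic, so every point where the quadratic is nonpositive
lies to its right. -/
theorem mul_alpha_le {a t H : ℝ} (hb : 0 < 1 - (a - 1) * t)
    (hD : 4 * t ≤ (1 - (a - 1) * t) ^ 2)
    (hH : H ^ 2 - (1 - (a - 1) * t) * H + t ≤ 0) : t * alpha a t ≤ H := by
  obtain ⟨_, h2, _, h4⟩ := alpha_spec hb hD
  by_contra hlt
  push Not at hlt
  nlinarith

theorem two_div_le_one_div_sq {a : ℝ} (ha : 1 ≤ a) :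
    2 / (5 * a + 6) ≤ 1 / (1 + √a) ^ 2 := by
  have hsa : √a ^ 2 = a := Real.sq_sqrt (by linarith)
  have hs : 0 ≤ √a := Real.sqrt_nonneg a
  rw [div_le_div_iff₀ (by positivity) (by positivity)]
  nlinarith [sq_nonneg (3 * √a - 2)]

theorem exp_seven_div_fifteen_lt : Real.exp (7 / 15) < 8 / 5 := by
  refine lt_of_pow_lt_pow_left₀ 15 (by norm_num) ?_
  rw [← Real.exp_nat_mul]
  have h : ((15 : ℕ) : ℝ) * (7 / 15) = (7 : ℕ) * 1 := by norm_num
  rw [h, Real.exp_nat_mul]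
  calc Real.exp 1 ^ 7 < (2.7182818286 : ℝ) ^ 7 :=
        pow_lt_pow_left₀ Real.exp_one_lt_d9 (Real.exp_pos _).le (by norm_num)
    _ < _ := by norm_num

theorem exp_twentyfour_div_fortythree_lt : Real.exp (24 / 43) < 86 / 49 := by
  refine lt_of_pow_lt_pow_left₀ 43 (by norm_num) ?_
  rw [← Real.exp_nat_mul]
  have h : ((43 : ℕ) : ℝ) * (24 / 43) = (24 : ℕ) * 1 := by norm_num
  rw [h, Real.exp_nat_mul]
  calc Real.exp 1 ^ 24 < (2.7182818286 : ℝ) ^ 24 :=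
        pow_lt_pow_left₀ Real.exp_one_lt_d9 (Real.exp_pos _).le (by norm_num)
    _ < _ := by norm_num

/-- The tangent line bound for `1 + 2 H` at the point `H₀`. -/
theorem one_add_two_mul_le {H H₀ : ℝ} (h₀ : 0 < 1 + 2 * H₀) :
    1 + 2 * H ≤ (1 + 2 * H₀) * Real.exp (2 * (H - H₀) / (1 + 2 * H₀)) := by
  have := Real.add_one_le_exp (2 * (H - H₀) / (1 + 2 * H₀))
  calc 1 + 2 * H = (1 + 2 * H₀) * (2 * (H - H₀) / (1 + 2 * H₀) + 1) := by field_simp; ring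
    _ ≤ _ := by gcongr

theorem exists_bound_mul_alpha {a t : ℝ} (ha : 1 ≤ a) (ht0 : 0 ≤ t)
    (ht : t ≤ 2 / (5 * a + 6)) :
    ∃ H : ℝ, t * alpha a t ≤ H ∧ (1 + 2 * H) * Real.exp (a * H) < 2 := by
  obtain ⟨hb, hD⟩ := discr_nonneg_of_le ha ht0 (ht.trans (two_div_le_one_div_sq ha))
  have ht' : t * (5 * a + 6) ≤ 2 := by rwa [le_div_iff₀ (by positivity)] at ht
  -- The side condition on `c` is exactly the sign of the quadratic at `2 / (3a + c)` in the extreme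
  -- case `t = 2 / (5a + 6)`. A larger `c` gives a sharper bound: `14/3` is the largest value
  -- admissible for arbitrarily large `a`, while `24/5` is admissible up to `a = 8.4`.
  have key : ∀ c : ℝ, 0 < c → 0 ≤ (14 - 3 * c) * a + 8 * c - 12 - c ^ 2 →
      t * alpha a t ≤ 2 / (3 * a + c) := by
    intro c hc hq
    refine mul_alpha_le hb hD ?_
    have hden : 0 < 3 * a + c := by positivity
    have e : (2 / (3 * a + c)) ^ 2 - (1 - (a - 1) * t) * (2 / (3 * a + c)) + t =
        (4 - 2 * (3 * a + c) + t * ((5 * a + c - 2) * (3 * a + c))) / (3 * a + c) ^ 2 := by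
      field_simp; ring
    rw [e]
    refine div_nonpos_of_nonpos_of_nonneg ?_ (by positivity)
    have h1 : t * ((5 * a + c - 2) * (3 * a + c)) ≤ t * ((3 * a + c - 2) * (5 * a + 6)) := by
      gcongr ?_ * ?_
      nlinarith
    have h2 : t * ((3 * a + c - 2) * (5 * a + 6)) ≤ (3 * a + c - 2) * 2 := by
      have : 0 ≤ 3 * a + c - 2 := by linarith
      nlinarith
    linarith
  rcases le_total a 8 with h8 | h8
  · refine ⟨_, key (24 / 5) (by norm_num) (by nlinarith), ?_⟩
    set H := 2 / (3 * a + 24 / 5) with hH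
    have haH : a * H = 2 / 3 - 8 / 5 * H := by rw [hH]; field_simp; ring
    -- At `H₀ = 1/8` the tangent exponent has slope `2 / (1 + 2H₀) = 8/5`, which cancels the `-8/5 *
    -- H` in `haH`; the product no longer depends on `H`.
    have h1 := one_add_two_mul_le (H := H) (H₀ := 1 / 8) (by norm_num)
    calc (1 + 2 * H) * Real.exp (a * H)
        ≤ ((1 + 2 * (1 / 8)) * Real.exp (2 * (H - 1 / 8) / (1 + 2 * (1 / 8))))
            * Real.exp (a * H) := by gcongr
      _ = 5 / 4 * Real.exp (7 / 15) := by
          rw [mul_assoc, ← Real.exp_add, haH]; ring_nf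
      _ < 2 := by linarith [exp_seven_div_fifteen_lt]
  · refine ⟨_, key (14 / 3) (by norm_num) (by nlinarith), ?_⟩
    set H := 2 / (3 * a + 14 / 3) with hH
    have haH : a * H = 2 / 3 - 14 / 9 * H := by rw [hH]; field_simp; ring
    have hH0 : H ≤ 3 / 43 := by
      rw [hH, div_le_div_iff₀ (by positivity) (by norm_num)]; linarith
    -- `3/43` is the value of `H` at `a = 8`. The combined exponent increases with `H`, so this
    -- endpoint is the worst case.
    have h1 := one_add_two_mul_le (H := H) (H₀ := 3 / 43) (by norm_num)
    calc (1 + 2 * H) * Real.exp (a * H)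
        ≤ ((1 + 2 * (3 / 43)) * Real.exp (2 * (H - 3 / 43) / (1 + 2 * (3 / 43))))
            * Real.exp (a * H) := by gcongr
      _ ≤ 49 / 43 * Real.exp (24 / 43) := by
          rw [mul_assoc, ← Real.exp_add, haH]
          gcongr
          · norm_num
          · norm_num; linarith
      _ < 2 := by linarith [exp_twentyfour_div_fortythree_lt]

/-! ### Products -/

theorem norm_prod_one_add_sub_one_le_prod {ι : Type*} (s : Finset ι) (u : ι → K) :
    ‖∏ j ∈ s, (1 + u j) - 1‖ ≤ ∏ j ∈ s, (1 + ‖u j‖) - 1 := by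
  classical
  induction s using Finset.induction_on with
  | empty => simp
  | insert i s hi ih =>
    rw [Finset.prod_insert hi, Finset.prod_insert hi]
    have e : (1 + u i) * ∏ j ∈ s, (1 + u j) - 1 =
        (1 + u i) * (∏ j ∈ s, (1 + u j) - 1) + u i := by ring
    rw [e]
    have h1 : ‖1 + u i‖ ≤ 1 + ‖u i‖ := (norm_add_le _ _).trans (by simp)
    calc _ ≤ ‖1 + u i‖ * ‖∏ j ∈ s, (1 + u j) - 1‖ + ‖u i‖ := by
          rw [← norm_mul]; exact norm_add_le _ _
      _ ≤ (1 + ‖u i‖) * (∏ j ∈ s, (1 + ‖u j‖) - 1) + ‖u i‖ := by gcongr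
      _ = _ := by ring

theorem prod_one_add_le_pow {ι : Type*} (s : Finset ι) (hs : s.Nonempty) (v : ι → ℝ)
    (hv : ∀ j ∈ s, 0 ≤ v j) {A : ℝ} (hA : ∑ j ∈ s, v j ≤ A) :
    ∏ j ∈ s, (1 + v j) ≤ (1 + A / s.card) ^ s.card := by
  have hm : (0 : ℝ) < s.card := by exact_mod_cast hs.card_pos
  have h := Real.geom_mean_le_arith_mean s (fun _ => (1 : ℝ)) (fun j => 1 + v j)
    (fun _ _ => zero_le_one) (by simpa using hs) (fun j hj => by linarith [hv j hj])
  simp only [Real.rpow_one, Finset.sum_const, nsmul_eq_mul, mul_one, one_mul,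
    Finset.sum_add_distrib] at h
  have hP : 0 ≤ ∏ j ∈ s, (1 + v j) := Finset.prod_nonneg fun j hj => by linarith [hv j hj]
  calc ∏ j ∈ s, (1 + v j) = ((∏ j ∈ s, (1 + v j)) ^ ((s.card : ℝ)⁻¹)) ^ s.card :=
        (Real.rpow_inv_natCast_pow hP hs.card_pos.ne').symm
    _ ≤ ((s.card + ∑ j ∈ s, v j) / s.card) ^ s.card := by gcongr
    _ ≤ (1 + A / s.card) ^ s.card := by
        have h0 : 0 ≤ ∑ j ∈ s, v j := Finset.sum_nonneg hv
        rw [add_div, div_self hm.ne']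
        gcongr

/-- By convexity, the graph lies below its chord on `[0, 1]`. This makes the product bound linear in
the inner error, as needed for the order of convergence. -/
theorem one_add_pow_le_of_le_one {r : ℝ} (h0 : 0 ≤ r) (h1 : r ≤ 1) (m : ℕ) :
    (1 + r) ^ m ≤ 1 + (2 ^ m - 1) * r := by
  induction m with
  | zero => simp
  | succ m ih =>
    have h2 : (0 : ℝ) ≤ 2 ^ m - 1 := by linarith [one_le_pow₀ (M₀ := ℝ) one_le_two (n := m)]
    rw [pow_succ, pow_succ]
    nlinarith [mul_le_mul_of_nonneg_right ih (by linarith : 0 ≤ 1 + r), mul_nonneg h2 h0,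
      mul_le_mul_of_nonneg_left h1 (mul_nonneg h2 h0)]

/-! ### The `p`-norm -/

theorem pNorm_nonneg {E : Type*} [NormedAddCommGroup E] {p : ℝ≥0∞} (hp : 1 ≤ p)
    (v : Fin n → E) : 0 ≤ pNorm p v := by
  have : Fact (1 ≤ p) := ⟨hp⟩
  exact norm_nonneg _

theorem norm_apply_le_pNorm {E : Type*} [NormedAddCommGroup E] {p : ℝ≥0∞} (hp : 1 ≤ p)
    (v : Fin n → E) (i : Fin n) : ‖v i‖ ≤ pNorm p v := by
  have : Fact (1 ≤ p) := ⟨hp⟩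
  exact PiLp.norm_apply_le (WithLp.toLp p v : PiLp p (fun _ : Fin n => E)) i

theorem pNorm_le_mul_pNorm {E F : Type*} [NormedAddCommGroup E] [NormedAddCommGroup F]
    {p : ℝ≥0∞} (hp : 1 ≤ p) (u : Fin n → E) (v : Fin n → F) {c : ℝ} (hc : 0 ≤ c)
    (h : ∀ i, ‖u i‖ ≤ c * ‖v i‖) : pNorm p u ≤ c * pNorm p v := by
  unfold pNorm
  rcases eq_or_ne p ∞ with rfl | hpt
  · simp only [PiLp.norm_toLp]
    exact (pi_norm_le_iff_of_nonneg (by positivity)).2 fun i =>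
      (h i).trans (by gcongr; exact norm_le_pi_norm v i)
  · have hp0 : 0 < p.toReal := ENNReal.toReal_pos (by positivity) hpt
    rw [PiLp.norm_eq_sum hp0, PiLp.norm_eq_sum hp0]
    calc (∑ i, ‖u i‖ ^ p.toReal) ^ (1 / p.toReal)
        ≤ (∑ i, (c * ‖v i‖) ^ p.toReal) ^ (1 / p.toReal) := by
          gcongr with i
          exact h i
      _ = (c ^ p.toReal * ∑ i, ‖v i‖ ^ p.toReal) ^ (1 / p.toReal) := by
          congr 1
          rw [Finset.mul_sum]
          exact Finset.sum_congr rfl fun i _ => Real.mul_rpow hc (norm_nonneg _)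
      _ = c * (∑ i, ‖v i‖ ^ p.toReal) ^ (1 / p.toReal) := by
          rw [Real.mul_rpow (by positivity) (Finset.sum_nonneg fun _ _ => by positivity),
            ← Real.rpow_mul hc, mul_one_div_cancel hp0.ne', Real.rpow_one]

theorem sum_erase_le_aConst_mul_pNorm (hn : 2 ≤ n) {p q : ℝ≥0∞}
    (hpq : ENNReal.HolderConjugate p q) (v : Fin n → ℝ) (hv : ∀ i, 0 ≤ v i) (i : Fin n) :
    ∑ j ∈ Finset.univ.erase i, v j ≤ aConst n q * pNorm p v := by
  have hcard : ((Finset.univ.erase i).card : ℝ) = (n : ℝ) - 1 := by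
    rw [Finset.card_erase_of_mem (Finset.mem_univ i), Finset.card_univ, Fintype.card_fin,
      Nat.cast_sub (by omega), Nat.cast_one]
  have hp1 : 1 ≤ p := ENNReal.HolderConjugate.one_le p q
  unfold aConst
  rcases eq_or_ne p ∞ with rfl | hpt
  · have hq : q = 1 := by
      have := ENNReal.HolderConjugate.inv_add_inv_eq_one ∞ q
      simpa using this
    subst hq
    simp only [inv_one, ENNReal.toReal_one, Real.rpow_one]
    rw [← hcard, ← nsmul_eq_mul]
    refine Finset.sum_le_card_nsmul _ _ _ fun j _ => ?_
    exact (le_abs_self _).trans (norm_apply_le_pNorm hp1 v j)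
  · have hp0 : 0 < p.toReal := ENNReal.toReal_pos (by positivity) hpt
    unfold pNorm
    rw [PiLp.norm_eq_sum hp0]
    have hsub : ∑ j ∈ Finset.univ.erase i, v j ^ p.toReal ≤ ∑ j, ‖v j‖ ^ p.toReal := by
      refine (Finset.sum_le_sum_of_subset_of_nonneg (Finset.erase_subset i _)
        fun j _ _ => Real.rpow_nonneg (hv j) _).trans_eq ?_
      exact Finset.sum_congr rfl fun j _ => by rw [Real.norm_of_nonneg (hv j)]
    have hS0 : 0 ≤ ∑ j ∈ Finset.univ.erase i, v j ^ p.toReal :=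
      Finset.sum_nonneg fun j _ => Real.rpow_nonneg (hv j) _
    rcases eq_or_ne q ∞ with rfl | hqt
    · have hp : p = 1 := by
        have := ENNReal.HolderConjugate.inv_add_inv_eq_one p ∞
        simpa using this
      subst hp
      simpa using hsub
    · have hc : p.toReal.HolderConjugate q.toReal :=
        ENNReal.HolderConjugate.toReal_of_ne_top hpt hqt
      have h := Real.inner_le_Lp_mul_Lq_of_nonneg (Finset.univ.erase i) (f := v)
        (g := fun _ => (1 : ℝ)) hc (fun j _ => hv j) (fun _ _ => zero_le_one)
      simp only [mul_one, Real.one_rpow, Finset.sum_const, nsmul_eq_mul] at h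
      rw [hcard] at h
      refine h.trans ?_
      rw [mul_comm, ENNReal.toReal_inv, one_div q.toReal]
      have : (0 : ℝ) ≤ (n : ℝ) - 1 := by rw [← hcard]; positivity
      gcongr

theorem one_le_aConst (hn : 2 ≤ n) (q : ℝ≥0∞) : 1 ≤ aConst n q := by
  have : (2 : ℝ) ≤ n := by exact_mod_cast hn
  exact Real.one_le_rpow (by linarith) ENNReal.toReal_nonneg

theorem div_rpow_eq_aConst_mul_div (hn : 2 ≤ n) {p q : ℝ≥0∞}
    (hpq : ENNReal.HolderConjugate p q) (t : ℝ) :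
    t / ((n : ℝ) - 1) ^ (p⁻¹).toReal = aConst n q * t / ((n : ℝ) - 1) := by
  have h2 : (2 : ℝ) ≤ n := by exact_mod_cast hn
  have hm : (0 : ℝ) < (n : ℝ) - 1 := by linarith
  have h1 : (p⁻¹).toReal + (q⁻¹).toReal = 1 := by
    have h := ENNReal.HolderConjugate.inv_add_inv_eq_one p q
    have hp : p⁻¹ ≠ ∞ := fun hh => by simp [hh] at h
    have hq : q⁻¹ ≠ ∞ := fun hh => by simp [hh] at h
    rw [← ENNReal.toReal_add hp hq, h, ENNReal.toReal_one]
  have h3 : ((n : ℝ) - 1) ^ (p⁻¹).toReal * aConst n q = (n : ℝ) - 1 := by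
    rw [aConst, ← Real.rpow_add hm, h1, Real.rpow_one]
  have h4 : 0 < ((n : ℝ) - 1) ^ (p⁻¹).toReal := Real.rpow_pos_of_pos hm _
  rw [div_eq_div_iff h4.ne' hm.ne']
  nth_rewrite 1 [← h3]
  ring

theorem Psi_eq (hn : 2 ≤ n) {p q : ℝ≥0∞} (hpq : ENNReal.HolderConjugate p q) (t : ℝ) :
    Psi n p t = (1 + 2 * t) * (1 + aConst n q * t / ((n : ℝ) - 1)) ^ (n - 1) := by
  rw [Psi, div_rpow_eq_aConst_mul_div hn hpq]

theorem Omega_lt_two (hn : 2 ≤ n) {p q : ℝ≥0∞} (hpq : ENNReal.HolderConjugate p q) {t : ℝ}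
    (ht0 : 0 ≤ t) (ht : t ≤ 2 / (5 * aConst n q + 6)) : Omega n p q t < 2 := by
  have h2 : (2 : ℝ) ≤ n := by exact_mod_cast hn
  have hm : (0 : ℝ) < (n : ℝ) - 1 := by linarith
  have ha := one_le_aConst hn q
  have ha0 : 0 ≤ aConst n q := by linarith
  obtain ⟨hb, hD⟩ := discr_nonneg_of_le ha ht0 (ht.trans (two_div_le_one_div_sq ha))
  obtain ⟨H, hH, hlt⟩ := exists_bound_mul_alpha ha ht0 ht
  have hα := (alpha_spec hb hD).1
  rw [Omega, Psi_eq hn hpq]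
  set h := t * alpha (aConst n q) t
  have h0 : 0 ≤ h := by positivity
  refine lt_of_le_of_lt ?_ hlt
  have hH0 : 0 ≤ H := h0.trans hH
  gcongr
  calc (1 + aConst n q * h / ((n : ℝ) - 1)) ^ (n - 1)
      ≤ Real.exp (aConst n q * h / ((n : ℝ) - 1)) ^ (n - 1) := by
        gcongr
        linarith [Real.add_one_le_exp (aConst n q * h / ((n : ℝ) - 1))]
    _ = Real.exp (aConst n q * h) := by
        rw [← Real.exp_nat_mul]
        congr 1
        rw [Nat.cast_sub (by omega), Nat.cast_one]
        field_simp
    _ ≤ Real.exp (aConst n q * H) := by gcongr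

/-- The consequences of `Ψ(h) < 2` used to localize zeros. -/
theorem contraction_of_Psi_lt_two (hn : 2 ≤ n) {a h : ℝ} (ha : 1 ≤ a) (h0 : 0 ≤ h)
    (hlt : (1 + 2 * h) * (1 + a * h / ((n : ℝ) - 1)) ^ (n - 1) < 2) :
    h < 1 / 2 ∧ a * h ^ 2 < (1 - h) ^ 2 := by
  have h2 : (2 : ℝ) ≤ n := by exact_mod_cast hn
  have hm : (0 : ℝ) < (n : ℝ) - 1 := by linarith
  have hB : 1 + a * h ≤ (1 + a * h / ((n : ℝ) - 1)) ^ (n - 1) := by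
    have hx : 0 ≤ a * h / ((n : ℝ) - 1) := by positivity
    have := one_add_mul_le_pow (a := a * h / ((n : ℝ) - 1)) (by linarith) (n - 1)
    rw [Nat.cast_sub (by omega), Nat.cast_one] at this
    calc 1 + a * h = 1 + ((n : ℝ) - 1) * (a * h / ((n : ℝ) - 1)) := by field_simp
      _ ≤ _ := this
  have h3 : (1 + 2 * h) * (1 + a * h) < 2 :=
    lt_of_le_of_lt (mul_le_mul_of_nonneg_left hB (by positivity)) hlt
  have h4 : h < 1 / 2 := by nlinarith [mul_nonneg (by linarith : 0 ≤ a) h0]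
  refine ⟨h4, ?_⟩
  -- `h3` bounds `a h` by `(1 - 2h) / (1 + 2h)`, so the claim reduces to `1 - h - h² + 2h³ > 0`,
  -- true for `h < 1/2`.
  nlinarith [mul_nonneg (by linarith : 0 ≤ a) h0, mul_nonneg h0 h0, mul_nonneg (mul_nonneg (by linarith : 0 ≤ a) h0) h0]

/-! ### Root vectors -/

open Polynomial in
theorem eval_eq_of_leadingCoeff_eq {f g : K[X]} (hf : f.natDegree = n) (hf0 : f ≠ 0)
    (hg : g.natDegree = n) (hlc : f.leadingCoeff = g.leadingCoeff) {x : Fin n → K}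
    (hx : Function.Injective x) (h : ∀ i, f.eval (x i) = g.eval (x i)) : f = g := by
  have hg0 : g ≠ 0 := by
    rw [← leadingCoeff_ne_zero, ← hlc]; exact leadingCoeff_ne_zero.2 hf0
  refine Polynomial.eq_of_degree_sub_lt_of_eval_index_eq (s := Finset.univ) (v := x)
    hx.injOn ?_ fun i _ => h i
  have hd : f.degree = g.degree := by
    rw [degree_eq_natDegree hf0, degree_eq_natDegree hg0, hf, hg]
  refine (degree_sub_lt_left hd hf0 hlc).trans_eq ?_
  rw [degree_eq_natDegree hf0, hf, Finset.card_univ, Fintype.card_fin]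

open Polynomial in
theorem natDegree_C_mul_prod {c : K} (hc : c ≠ 0) (y : Fin n → K) :
    (C c * ∏ i, (X - C (y i))).natDegree = n := by
  rw [natDegree_C_mul hc, natDegree_prod_of_monic _ _ fun i _ => monic_X_sub_C _]
  simp

open Polynomial in
theorem leadingCoeff_C_mul_prod (c : K) (y : Fin n → K) :
    (C c * ∏ i, (X - C (y i))).leadingCoeff = c := by
  rw [leadingCoeff_mul, leadingCoeff_C, (monic_prod_of_monic _ _ fun i _ =>
    monic_X_sub_C (y i)).leadingCoeff, mul_one]

open Polynomial in
theorem eq_C_mul_prod_of_isRoot {f : K[X]} (hf : f.natDegree = n) (hf0 : f ≠ 0)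
    {ξ : Fin n → K} (hξ : Function.Injective ξ) (h : ∀ i, f.IsRoot (ξ i)) :
    f = C f.leadingCoeff * ∏ i, (X - C (ξ i)) := by
  refine eval_eq_of_leadingCoeff_eq hf hf0
    (natDegree_C_mul_prod (leadingCoeff_ne_zero.2 hf0) ξ) (leadingCoeff_C_mul_prod _ _).symm hξ
    fun i => ?_
  rw [(h i).eq_zero, eval_mul, eval_prod, Finset.prod_eq_zero (Finset.mem_univ i) (by simp),
    mul_zero]

open Polynomial in
theorem onlySimpleZeros_of_isRoot {f : K[X]} (hf : f.natDegree = n) (hf0 : f ≠ 0)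
    {ξ : Fin n → K} (hξ : Function.Injective ξ) (h : ∀ i, f.IsRoot (ξ i)) :
    OnlySimpleZeros f := by
  classical
  intro z hz
  have e := eq_C_mul_prod_of_isRoot hf hf0 hξ h
  have hroots : f.roots = Finset.univ.val.map ξ := by
    rw [e, roots_C_mul _ (leadingCoeff_ne_zero.2 hf0)]
    exact roots_multiset_prod_X_sub_C (Finset.univ.val.map ξ) ▸ by
      simp [Finset.prod, Function.comp_def]
  rw [← count_roots]
  refine Multiset.count_eq_one_of_mem ?_ ((mem_roots hf0).2 hz)
  rw [hroots]
  exact Finset.univ.nodup.map hξ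

/-! ### Existence of zeros in closed balls -/

open Polynomial in
-- Substitute for completeness. There are finitely many roots; if all lie outside the ball, they
-- keep a distance `δ` from it, and the factorization bounds `|f|` below on the ball by a positive
-- constant.
theorem exists_isRoot_norm_sub_le [IsAlgClosed K] {f : K[X]} (hf0 : f ≠ 0) {c : K} {ρ : ℝ}
    {z : ℕ → K} (hz : ∀ k, ‖z k - c‖ ≤ ρ)
    (hlim : Tendsto (fun k => f.eval (z k)) atTop (𝓝 0)) :
    ∃ ζ, f.IsRoot ζ ∧ ‖ζ - c‖ ≤ ρ := by
  by_contra! hcon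
  have hδ : ∃ δ : ℝ, 0 < δ ∧ ∀ ζ ∈ f.roots, ρ + δ ≤ ‖ζ - c‖ := by
    have : ∀ s : Multiset K, (∀ ζ ∈ s, ρ < ‖ζ - c‖) →
        ∃ δ : ℝ, 0 < δ ∧ ∀ ζ ∈ s, ρ + δ ≤ ‖ζ - c‖ := by
      intro s
      induction s using Multiset.induction_on with
      | empty => exact fun _ => ⟨1, one_pos, by simp⟩
      | cons ζ s ih =>
        intro hs
        obtain ⟨δ, hδ0, hδ⟩ := ih fun ζ' h' => hs ζ' (Multiset.mem_cons_of_mem h')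
        have hζ := hs ζ (Multiset.mem_cons_self ζ s)
        refine ⟨min δ (‖ζ - c‖ - ρ), lt_min hδ0 (sub_pos.2 hζ), fun ζ' h' => ?_⟩
        rcases Multiset.mem_cons.1 h' with rfl | h'
        · linarith [min_le_right δ (‖ζ' - c‖ - ρ)]
        · linarith [min_le_left δ (‖ζ - c‖ - ρ), hδ ζ' h']
    exact this _ fun ζ hζ => hcon ζ (isRoot_of_mem_roots hζ)
  obtain ⟨δ, hδ0, hδ⟩ := hδ
  have hsplit := IsAlgClosed.splits f
  have hbound : ∀ k, ‖f.leadingCoeff‖ * δ ^ f.roots.card ≤ ‖f.eval (z k)‖ := by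
    intro k
    rw [hsplit.eval_eq_prod_roots, norm_mul]
    gcongr
    have : ∀ s : Multiset K, (∀ ζ ∈ s, ρ + δ ≤ ‖ζ - c‖) →
        δ ^ s.card ≤ ‖(s.map (z k - ·)).prod‖ := by
      intro s
      induction s using Multiset.induction_on with
      | empty => simp
      | cons ζ s ih =>
        intro hs
        rw [Multiset.card_cons, Multiset.map_cons, Multiset.prod_cons, norm_mul, pow_succ']
        have h1 := ih fun ζ' h' => hs ζ' (Multiset.mem_cons_of_mem h')
        have h2 := hs ζ (Multiset.mem_cons_self ζ s)
        have h3 : ‖ζ - c‖ ≤ ‖z k - ζ‖ + ‖z k - c‖ := by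
          have := norm_add_le (ζ - z k) (z k - c)
          rwa [sub_add_sub_cancel, norm_sub_rev ζ (z k)] at this
        have h4 := hz k
        gcongr
        linarith
    exact this _ hδ
  have hpos : 0 < ‖f.leadingCoeff‖ * δ ^ f.roots.card :=
    mul_pos (norm_pos_iff.2 (leadingCoeff_ne_zero.2 hf0)) (pow_pos hδ0 _)
  have h0 := hlim.norm
  rw [norm_zero] at h0
  exact absurd (ge_of_tendsto' h0 hbound) (not_le.2 hpos)

/-- If `Φ` maps the closed ball into itself, is a contraction there and controls `f`, then `f` has
a zero in this ball. -/
theorem exists_isRoot_of_contraction [IsAlgClosed K] {f : K[X]} (hf0 : f ≠ 0) {c : K} {ρ : ℝ}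
    (hρ : 0 ≤ ρ) {Φ : K → K} {κ B : ℝ} (hκ0 : 0 ≤ κ) (hκ : κ < 1)
    (hmaps : ∀ z, ‖z - c‖ ≤ ρ → ‖Φ z - c‖ ≤ ρ)
    (hcontr : ∀ z y, ‖z - c‖ ≤ ρ → ‖y - c‖ ≤ ρ → ‖Φ z - Φ y‖ ≤ κ * ‖z - y‖)
    (hf : ∀ z, ‖z - c‖ ≤ ρ → ‖f.eval z‖ ≤ B * ‖Φ z - z‖) :
    ∃ ζ, f.IsRoot ζ ∧ ‖ζ - c‖ ≤ ρ := by
  have hz : ∀ k, ‖Φ^[k] c - c‖ ≤ ρ := by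
    intro k
    induction k with
    | zero => simpa using hρ
    | succ k ih => rw [Function.iterate_succ_apply']; exact hmaps _ ih
  refine exists_isRoot_norm_sub_le hf0 hz ?_
  have hstep : ∀ k, ‖Φ (Φ^[k] c) - Φ^[k] c‖ ≤ κ ^ k * ‖Φ c - c‖ := by
    intro k
    induction k with
    | zero => simp
    | succ k ih =>
      rw [Function.iterate_succ_apply']
      calc _ ≤ κ * ‖Φ (Φ^[k] c) - Φ^[k] c‖ := hcontr _ _ (hmaps _ (hz k)) (hz k)
        _ ≤ κ * (κ ^ k * ‖Φ c - c‖) := by gcongr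
        _ = _ := by ring
  refine squeeze_zero_norm (a := fun k => |B| * (κ ^ k * ‖Φ c - c‖)) (fun k => ?_) ?_
  · refine (hf _ (hz k)).trans ?_
    calc _ ≤ |B| * ‖Φ (Φ^[k] c) - Φ^[k] c‖ := by gcongr; exact le_abs_self B
      _ ≤ _ := by gcongr; exact hstep k
  · have := ((tendsto_pow_atTop_nhds_zero_of_lt_one hκ0 hκ).mul_const ‖Φ c - c‖).const_mul |B|
    simpa using this

open Polynomial in
/-- Lagrange interpolation of `f` at the points `x₁, …, xₙ`. -/
theorem eval_eq_lagrange {f : K[X]} (hf : f.natDegree = n) (hf0 : f ≠ 0) {x : Fin n → K}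
    (hx : Function.Injective x) (z : K) :
    f.eval z = f.leadingCoeff * (∏ j, (z - x j) +
      ∑ i, correction f x i * ∏ j ∈ Finset.univ.erase i, (z - x j)) := by
  have ha0 := leadingCoeff_ne_zero.2 hf0
  set g := C f.leadingCoeff * ∏ j, (X - C (x j)) with hg
  have hgn : g.natDegree = n := natDegree_C_mul_prod ha0 x
  have hg0 : g ≠ 0 := by
    rw [← leadingCoeff_ne_zero, hg, leadingCoeff_C_mul_prod]; exact ha0
  have hgx : ∀ i, g.eval (x i) = 0 := fun i => by
    rw [hg, eval_mul, eval_prod, Finset.prod_eq_zero (Finset.mem_univ i) (by simp), mul_zero]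
  have hdeg : (f - g).degree < (Finset.univ : Finset (Fin n)).card := by
    have hd : f.degree = g.degree := by
      rw [degree_eq_natDegree hf0, degree_eq_natDegree hg0, hf, hgn]
    refine (degree_sub_lt_left hd hf0 (leadingCoeff_C_mul_prod _ _).symm).trans_eq ?_
    rw [degree_eq_natDegree hf0, hf, Finset.card_univ, Fintype.card_fin]
  have h := congrArg (eval z) (Lagrange.eq_interpolate_of_eval_eq (s := Finset.univ) (v := x)
    (fun i => f.eval (x i)) hx.injOn hdeg fun i _ => by rw [eval_sub, hgx, sub_zero])
  have hgz : g.eval z = f.leadingCoeff * ∏ j, (z - x j) := by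
    rw [hg, eval_mul, eval_prod]; simp
  rw [eval_sub, sub_eq_iff_eq_add, hgz, Lagrange.interpolate_apply, eval_finsetSum] at h
  rw [h, mul_add, add_comm, Finset.mul_sum]
  congr 1
  refine Finset.sum_congr rfl fun i _ => ?_
  have hne : ∏ j ∈ Finset.univ.erase i, (x i - x j) ≠ 0 :=
    Finset.prod_ne_zero_iff.2 fun j hj => sub_ne_zero.2 (hx.ne (Finset.ne_of_mem_erase hj).symm)
  rw [eval_mul, eval_C, Lagrange.basis, eval_prod, correction]
  simp only [Lagrange.basisDivisor, eval_mul, eval_C, eval_sub, eval_X, Finset.prod_mul_distrib,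
    Finset.prod_inv_distrib]
  field_simp

/-- Exhibits the zeros of `f` away from the other nodes as the fixed points of `z ↦ x i - W_i / (1 +
S z)`, wherever `1 + S z ≠ 0`. -/
theorem eval_eq_of_sub_ne_zero {f : K[X]} (hf : f.natDegree = n) (hf0 : f ≠ 0) {x : Fin n → K}
    (hx : Function.Injective x) (i : Fin n) {z : K}
    (hz : ∀ j ∈ Finset.univ.erase i, z - x j ≠ 0) :
    f.eval z = f.leadingCoeff * (∏ j ∈ Finset.univ.erase i, (z - x j)) *
      ((z - x i) * (1 + ∑ j ∈ Finset.univ.erase i, correction f x j / (z - x j))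
        + correction f x i) := by
  rw [eval_eq_lagrange hf hf0 hx, ← Finset.mul_prod_erase _ _ (Finset.mem_univ i),
    ← Finset.add_sum_erase _ _ (Finset.mem_univ i)]
  have h : ∑ j ∈ Finset.univ.erase i, correction f x j * ∏ l ∈ Finset.univ.erase j, (z - x l) =
      (∏ j ∈ Finset.univ.erase i, (z - x j)) * ((z - x i) *
        ∑ j ∈ Finset.univ.erase i, correction f x j / (z - x j)) := by
    rw [Finset.mul_sum, Finset.mul_sum]
    refine Finset.sum_congr rfl fun j hj => ?_
    have hij : i ∈ Finset.univ.erase j :=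
      Finset.mem_erase.2 ⟨(Finset.ne_of_mem_erase hj).symm, Finset.mem_univ i⟩
    rw [← Finset.mul_prod_erase _ _ hij, ← Finset.mul_prod_erase _ _ hj,
      Finset.erase_right_comm]
    field_simp [hz j hj]
  rw [h]
  ring

/-! ### Localization of zeros -/

/-- The zero near `x_i`, in terms of weights `w_j` with `|W_i| ≤ w_i |x_i - x_j|`. -/
theorem exists_isRoot_near [IsAlgClosed K] {f : K[X]} (hf : f.natDegree = n) (hf0 : f ≠ 0)
    {x : Fin n → K} (hx : Function.Injective x) {w : Fin n → ℝ} (hw0 : ∀ i, 0 ≤ w i)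
    (hw : ∀ i j, i ≠ j → ‖correction f x i‖ ≤ w i * ‖x i - x j‖)
    {a t α : ℝ} (ha : 0 ≤ a) (hα : 0 < α) (hwt : ∀ i, w i ≤ t)
    (hsum : ∀ i, ∑ j ∈ Finset.univ.erase i, w j ≤ a * t)
    (hα1 : a * t * α ≤ (α - 1) * (1 - t * α)) (hlt : t * α < 1)
    (hc : a * (t * α) ^ 2 < (1 - t * α) ^ 2) (i : Fin n) :
    ∃ ζ, f.IsRoot ζ ∧ ‖ζ - x i‖ ≤ α * ‖correction f x i‖ := by
  have ht0 : 0 ≤ t := (hw0 i).trans (hwt i)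
  set ρ := α * ‖correction f x i‖ with hρ
  set h := t * α with hh
  have h1h : 0 < 1 - h := by linarith
  set S : K → K := fun z => ∑ j ∈ Finset.univ.erase i, correction f x j / (z - x j) with hS
  have hD : ∀ j ∈ Finset.univ.erase i, 0 < ‖x i - x j‖ := fun j hj =>
    norm_pos_iff.2 (sub_ne_zero.2 (hx.ne (Finset.ne_of_mem_erase hj).symm))
  have hWD : ∀ j ∈ Finset.univ.erase i, ‖correction f x i‖ ≤ t * ‖x i - x j‖ := fun j hj =>
    (hw i j (Finset.ne_of_mem_erase hj).symm).trans (by gcongr; exact hwt i)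
  have hWj : ∀ j ∈ Finset.univ.erase i, ‖correction f x j‖ ≤ w j * ‖x i - x j‖ := fun j hj => by
    rw [norm_sub_rev]; exact hw j i (Finset.ne_of_mem_erase hj)
  have hdist : ∀ z, ‖z - x i‖ ≤ ρ → ∀ j ∈ Finset.univ.erase i,
      (1 - h) * ‖x i - x j‖ ≤ ‖z - x j‖ := by
    intro z hz j hj
    have h1 : ‖x i - x j‖ ≤ ‖z - x j‖ + ‖z - x i‖ := by
      have := norm_sub_le (z - x j) (z - x i)
      rwa [sub_sub_sub_cancel_left] at this
    have h2 : ρ ≤ h * ‖x i - x j‖ := by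
      rw [hρ, hh]
      calc α * ‖correction f x i‖ ≤ α * (t * ‖x i - x j‖) := by gcongr; exact hWD j hj
        _ = _ := by ring
    linarith
  have hpos : ∀ z, ‖z - x i‖ ≤ ρ → ∀ j ∈ Finset.univ.erase i, 0 < ‖z - x j‖ :=
    fun z hz j hj => lt_of_lt_of_le (mul_pos h1h (hD j hj)) (hdist z hz j hj)
  have hSle : ∀ z, ‖z - x i‖ ≤ ρ → ‖S z‖ ≤ 1 - 1 / α := by
    intro z hz
    calc ‖S z‖ ≤ ∑ j ∈ Finset.univ.erase i, w j / (1 - h) := by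
          refine (norm_sum_le _ _).trans (Finset.sum_le_sum fun j hj => ?_)
          rw [norm_div, div_le_div_iff₀ (hpos z hz j hj) h1h]
          calc ‖correction f x j‖ * (1 - h) ≤ w j * ‖x i - x j‖ * (1 - h) := by
                gcongr; exact hWj j hj
            _ = w j * ((1 - h) * ‖x i - x j‖) := by ring
            _ ≤ _ := by gcongr; exacts [hw0 j, hdist z hz j hj]
      _ ≤ a * t / (1 - h) := by rw [← Finset.sum_div]; gcongr; exact hsum i
      _ ≤ 1 - 1 / α := by
          rw [div_le_iff₀ h1h, one_sub_div hα.ne', div_mul_eq_mul_div, le_div_iff₀ hα]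
          exact hα1
  have h1S : ∀ z, ‖z - x i‖ ≤ ρ → 1 / α ≤ ‖1 + S z‖ := by
    intro z hz
    have h1 := norm_sub_le (1 + S z) (S z)
    rw [add_sub_cancel_right, norm_one] at h1
    linarith [hSle z hz]
  have h1Spos : ∀ z, ‖z - x i‖ ≤ ρ → 0 < ‖1 + S z‖ := fun z hz =>
    lt_of_lt_of_le (by positivity) (h1S z hz)
  -- The factor `|W_i|` is kept on the left because `|W_i| |W_j| ≤ t w_j |x_i - x_j|²` cancels the
  -- squared distance in the denominator, leaving a scale-free constant.
  have hSlip : ∀ z y, ‖z - x i‖ ≤ ρ → ‖y - x i‖ ≤ ρ →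
      ‖correction f x i‖ * ‖S z - S y‖ ≤ a * t ^ 2 / (1 - h) ^ 2 * ‖z - y‖ := by
    intro z y hz hy
    rw [hS, ← Finset.sum_sub_distrib]
    calc _ ≤ ∑ j ∈ Finset.univ.erase i, t * w j / (1 - h) ^ 2 * ‖z - y‖ := by
          refine (mul_le_mul_of_nonneg_left (norm_sum_le _ _) (norm_nonneg _)).trans ?_
          rw [Finset.mul_sum]
          refine Finset.sum_le_sum fun j hj => ?_
          have hz' := hpos z hz j hj
          have hy' := hpos y hy j hj
          have e : correction f x j / (z - x j) - correction f x j / (y - x j) =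
              correction f x j * (y - z) / ((z - x j) * (y - x j)) := by
            have := norm_pos_iff.1 hz'
            have := norm_pos_iff.1 hy'
            field_simp
            ring
          have hDj := hD j hj
          rw [e, norm_div, norm_mul, norm_mul, norm_sub_rev y z]
          have hden : ((1 - h) * ‖x i - x j‖) * ((1 - h) * ‖x i - x j‖) ≤
              ‖z - x j‖ * ‖y - x j‖ := by
            gcongr
            exacts [hdist z hz j hj, hdist y hy j hj]
          have hwj := hw0 j
          calc _ ≤ t * ‖x i - x j‖ * (w j * ‖x i - x j‖ * ‖z - y‖ /
                (((1 - h) * ‖x i - x j‖) * ((1 - h) * ‖x i - x j‖))) := by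
                gcongr
                exacts [hWD j hj, hWj j hj]
            _ = _ := by field_simp
      _ = (∑ j ∈ Finset.univ.erase i, w j) * (t / (1 - h) ^ 2 * ‖z - y‖) := by
          rw [Finset.sum_mul]
          exact Finset.sum_congr rfl fun j _ => by ring
      _ ≤ (a * t) * (t / (1 - h) ^ 2 * ‖z - y‖) := by gcongr; exact hsum i
      _ = _ := by ring
  -- The lower bound `1/α` for `|1 + S|` gives invariance of the ball. Used twice, it multiplies the
  -- constant of `hSlip` by `α²`, which yields `κ`.
  refine exists_isRoot_of_contraction hf0 (by positivity)
    (Φ := fun z => x i - correction f x i / (1 + S z)) (κ := a * h ^ 2 / (1 - h) ^ 2)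
    (B := ‖f.leadingCoeff‖ * (∏ j ∈ Finset.univ.erase i, (ρ + ‖x i - x j‖)) * 2)
    (by positivity) ((div_lt_one (by positivity)).2 hc) ?_ ?_ ?_
  · intro z hz
    rw [sub_sub_cancel_left, norm_neg, norm_div, hρ, div_le_iff₀ (h1Spos z hz)]
    have := mul_le_mul_of_nonneg_left (h1S z hz) (mul_nonneg hα.le (norm_nonneg (correction f x i)))
    refine le_trans (le_of_eq ?_) this
    field_simp
  · intro z y hz hy
    have hz' := h1Spos z hz
    have hy' := h1Spos y hy
    have e : x i - correction f x i / (1 + S z) - (x i - correction f x i / (1 + S y)) =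
        correction f x i * (S z - S y) / ((1 + S z) * (1 + S y)) := by
      have := norm_pos_iff.1 hz'
      have := norm_pos_iff.1 hy'
      field_simp
      ring
    rw [e, norm_div, norm_mul, norm_mul]
    calc _ ≤ a * t ^ 2 / (1 - h) ^ 2 * ‖z - y‖ / (1 / α * (1 / α)) := by
          exact div_le_div₀ (by positivity) (hSlip z y hz hy) (by positivity)
            (mul_le_mul (h1S z hz) (h1S y hy) (by positivity) (norm_nonneg _))
      _ = _ := by rw [hh]; field_simp
  · intro z hz
    have hz' := norm_pos_iff.1 (h1Spos z hz)
    rw [eval_eq_of_sub_ne_zero hf hf0 hx i fun j hj => norm_pos_iff.1 (hpos z hz j hj)]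
    have e : (z - x i) * (1 + S z) + correction f x i =
        -((1 + S z) * (x i - correction f x i / (1 + S z) - z)) := by
      field_simp
      ring
    have e' : (z - x i) * (1 + ∑ j ∈ Finset.univ.erase i, correction f x j / (z - x j))
        + correction f x i = -((1 + S z) * (x i - correction f x i / (1 + S z) - z)) := e
    rw [e', norm_mul, norm_mul, norm_neg, norm_mul, norm_prod, ← mul_assoc]
    have h2 : ‖1 + S z‖ ≤ 2 := by
      have h1 := norm_add_le 1 (S z)
      rw [norm_one] at h1
      have : 0 < 1 / α := by positivity
      linarith [hSle z hz]
    gcongr with j hj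
    have := norm_add_le (z - x i) (x i - x j)
    rw [sub_add_sub_cancel] at this
    linarith

/-! ### Initial conditions -/

theorem minDist_le (x : Fin n → K) {i j : Fin n} (hij : i ≠ j) : minDist x i ≤ ‖x i - x j‖ :=
  ciInf_le (f := fun j : {j : Fin n // j ≠ i} => ‖x i - x j‖)
    ⟨0, by rintro _ ⟨j, rfl⟩; exact norm_nonneg _⟩ ⟨j, hij.symm⟩

theorem minDist_pos (hn : 2 ≤ n) {x : Fin n → K} (hx : Function.Injective x) (i : Fin n) :
    0 < minDist x i := by
  have : Nontrivial (Fin n) := Fin.nontrivial_iff_two_le.2 hn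
  obtain ⟨j, hj⟩ := exists_ne i
  have : Nonempty {j : Fin n // j ≠ i} := ⟨⟨j, hj⟩⟩
  obtain ⟨k, hk⟩ := exists_eq_ciInf_of_finite (f := fun j : {j : Fin n // j ≠ i} => ‖x i - x j‖)
  rw [minDist, ← hk]
  exact norm_pos_iff.2 (sub_ne_zero.2 (hx.ne k.2.symm))

/-- The vector `x` approximates the root-vector `ξ` with relative errors at most `v`, where `v` is
small enough for the local convergence of the Weierstrass-type iterations. -/
structure IsApprox (v : Fin n → ℝ) (s b : ℝ) (x ξ : Fin n → K) : Prop where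
  injective : Function.Injective x
  nonneg : ∀ i, 0 ≤ v i
  le : ∀ i, v i ≤ s
  prod_le : ∀ i, ∏ j ∈ Finset.univ.erase i, (1 + v j) ≤ 1 + b
  scale_nonneg : 0 ≤ s
  rate_nonneg : 0 ≤ b
  lt_two : (1 + 2 * s) * (1 + b) < 2
  close : ∀ i j, i ≠ j → ‖x i - ξ i‖ ≤ v i * ‖x i - x j‖

theorem initFun_nonneg {p : ℝ≥0∞} (hp : 1 ≤ p) (f : K[X]) (x : Fin n → K) :
    0 ≤ initFun p f x := pNorm_nonneg hp _

/-- Localization of the zeros of `f` by the function of initial conditions. -/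
theorem exists_roots_of_initFun_le [IsAlgClosed K] (hn : 2 ≤ n) {f : K[X]}
    (hf : f.natDegree = n) {p q : ℝ≥0∞} (hpq : ENNReal.HolderConjugate p q) {x : Fin n → K}
    (hx : Function.Injective x) (hE : initFun p f x ≤ 1 / (1 + √(aConst n q)) ^ 2)
    (hΩ : Omega n p q (initFun p f x) < 2) :
    ∃ (ξ : Fin n → K) (v : Fin n → ℝ) (s b : ℝ),
      Function.Injective ξ ∧ (∀ i, f.IsRoot (ξ i)) ∧ IsApprox v s b x ξ ∧
      ∀ i, ‖x i - ξ i‖ ≤ alpha (aConst n q) (initFun p f x) * ‖correction f x i‖ := by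
  have hp1 : 1 ≤ p := ENNReal.HolderConjugate.one_le p q
  have hf0 : f ≠ 0 := by rintro rfl; simp at hf; omega
  have h2 : (2 : ℝ) ≤ n := by exact_mod_cast hn
  have hm : (0 : ℝ) < (n : ℝ) - 1 := by linarith
  have ha := one_le_aConst hn q
  have ht0 : 0 ≤ initFun p f x := initFun_nonneg hp1 f x
  obtain ⟨hb, hD⟩ := discr_nonneg_of_le ha ht0 hE
  obtain ⟨hα, hquad, hαeq, -⟩ := alpha_spec hb hD
  rw [Omega, Psi_eq hn hpq] at hΩ
  set w : Fin n → ℝ := fun i => ‖correction f x i‖ / minDist x i with hw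
  have hw0 : ∀ i, 0 ≤ w i := fun i => div_nonneg (norm_nonneg _) (minDist_pos hn hx i).le
  have hwt : ∀ i, w i ≤ initFun p f x := fun i =>
    (le_abs_self _).trans (norm_apply_le_pNorm hp1 w i)
  have hsum : ∀ i, ∑ j ∈ Finset.univ.erase i, w j ≤ aConst n q * initFun p f x :=
    sum_erase_le_aConst_mul_pNorm hn hpq w hw0
  have hwd : ∀ i j, i ≠ j → ‖correction f x i‖ ≤ w i * ‖x i - x j‖ := fun i j hij => by
    have hd := minDist_pos hn hx i
    calc ‖correction f x i‖ = w i * minDist x i := by rw [hw]; field_simp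
      _ ≤ _ := mul_le_mul_of_nonneg_left (minDist_le x hij) (hw0 i)
  set t := initFun p f x
  set a := aConst n q
  set α := alpha a t
  have hh0 : 0 ≤ t * α := by positivity
  obtain ⟨hhalf, hc⟩ := contraction_of_Psi_lt_two hn ha hh0 hΩ
  -- In fact an equality: a rearrangement of `hαeq`.
  have hα1 : a * t * α ≤ (α - 1) * (1 - t * α) := by nlinarith
  have hex := fun i => exists_isRoot_near hf hf0 hx hw0 hwd (by linarith) hα hwt hsum hα1
    (by linarith) hc i
  choose ξ hroot hξ using hex
  have hclose : ∀ i j, i ≠ j → ‖x i - ξ i‖ ≤ α * w i * ‖x i - x j‖ := fun i j hij => by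
    rw [norm_sub_rev]
    calc _ ≤ α * ‖correction f x i‖ := hξ i
      _ ≤ α * (w i * ‖x i - x j‖) := by gcongr; exact hwd i j hij
      _ = _ := by ring
  have hv : ∀ i, α * w i ≤ t * α := fun i => by rw [mul_comm t]; gcongr; exact hwt i
  have hb1 : 1 ≤ (1 + a * (t * α) / ((n : ℝ) - 1)) ^ (n - 1) := by
    have : 0 ≤ a * (t * α) / ((n : ℝ) - 1) := by positivity
    exact one_le_pow₀ (by linarith)
  -- With these choices `(1 + 2s)(1 + b)` is exactly `Ψ(t α)`, and `b` comes from the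
  -- arithmetic-geometric mean inequality applied to the factors `1 + α w_j`.
  refine ⟨ξ, fun i => α * w i, t * α, (1 + a * (t * α) / ((n : ℝ) - 1)) ^ (n - 1) - 1, ?_, hroot,
    ⟨hx, fun i => mul_nonneg hα.le (hw0 i), hv, fun i => ?_, hh0, by linarith, ?_, hclose⟩,
    fun i => ?_⟩
  · intro i j hij
    by_contra hne
    have hD := norm_pos_iff.2 (sub_ne_zero.2 (hx.ne hne))
    have h1 := hclose i j hne
    have h2 := hclose j i (Ne.symm hne)
    rw [norm_sub_rev (x j) (x i), ← hij] at h2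
    have h3 : ‖x i - x j‖ ≤ ‖x i - ξ i‖ + ‖x j - ξ i‖ := by
      have := norm_sub_le (x i - ξ i) (x j - ξ i)
      rwa [sub_sub_sub_cancel_right] at this
    have h4 := mul_le_mul_of_nonneg_right (hv i) hD.le
    have h5 := mul_le_mul_of_nonneg_right (hv j) hD.le
    nlinarith
  · have hcard : (Finset.univ.erase i).card = n - 1 := by
      rw [Finset.card_erase_of_mem (Finset.mem_univ i), Finset.card_univ, Fintype.card_fin]
    have hcard' : ((Finset.univ.erase i).card : ℝ) = (n : ℝ) - 1 := by
      rw [hcard, Nat.cast_sub (by omega), Nat.cast_one]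
    have h := prod_one_add_le_pow (Finset.univ.erase i)
      (Finset.card_pos.1 (by omega)) (fun j => α * w j)
      (fun j _ => mul_nonneg hα.le (hw0 j)) (A := a * (t * α)) (by
        rw [← Finset.mul_sum]
        calc _ ≤ α * (a * t) := by gcongr; exact hsum i
          _ = _ := by ring)
    rw [hcard', hcard] at h
    linarith
  · rw [add_sub_cancel]; exact hΩ
  · rw [norm_sub_rev]; exact hξ i

/-! ### Local convergence -/

section Local

variable {f : K[X]} {ξ : Fin n → K}

/-- Each factor `(x i - ξ j) / (x i - y j)` is `1` plus the relative error of `y j`. The new error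
is thus the old one times a quantity that vanishes when `y = ξ`. -/
theorem step_sub_eq (hf0 : f ≠ 0) (hξ : ∀ z, f.eval z = f.leadingCoeff * ∏ i, (z - ξ i))
    {x y : Fin n → K} (h : Sharp x y) (i : Fin n) :
    x i - f.eval (x i) / (f.leadingCoeff * ∏ j ∈ Finset.univ.erase i, (x i - y j)) - ξ i =
      -((x i - ξ i) * (∏ j ∈ Finset.univ.erase i, (1 + (y j - ξ j) / (x i - y j)) - 1)) := by
  have ha0 := Polynomial.leadingCoeff_ne_zero.2 hf0
  have hne : ∀ j ∈ Finset.univ.erase i, x i - y j ≠ 0 := fun j hj =>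
    sub_ne_zero.2 (h i j (Finset.ne_of_mem_erase hj).symm)
  have e : ∏ j ∈ Finset.univ.erase i, (1 + (y j - ξ j) / (x i - y j)) =
      (∏ j ∈ Finset.univ.erase i, (x i - ξ j)) / ∏ j ∈ Finset.univ.erase i, (x i - y j) := by
    rw [← Finset.prod_div_distrib]
    refine Finset.prod_congr rfl fun j hj => ?_
    have := hne j hj
    field_simp
    ring
  have hP := Finset.prod_ne_zero_iff.2 hne
  rw [hξ, ← Finset.mul_prod_erase _ _ (Finset.mem_univ i), e]
  field_simp
  ring

theorem norm_iterFun_succ_sub_le (hf0 : f ≠ 0)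
    (hξ : ∀ z, f.eval z = f.leadingCoeff * ∏ i, (z - ξ i)) {x : Fin n → K} {M : ℕ}
    (h : Sharp x (iterFun f M x)) (i : Fin n) {u : Fin n → ℝ}
    (hu : ∀ j, i ≠ j → ‖iterFun f M x j - ξ j‖ ≤ u j * ‖x i - iterFun f M x j‖) :
    ‖iterFun f (M + 1) x i - ξ i‖ ≤
      ‖x i - ξ i‖ * (∏ j ∈ Finset.univ.erase i, (1 + u j) - 1) := by
  rw [iterFun, step_sub_eq hf0 hξ h, norm_neg, norm_mul]
  gcongr
  refine (norm_prod_one_add_sub_one_le_prod _ _).trans ?_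
  gcongr with j hj
  have hij := (Finset.ne_of_mem_erase hj).symm
  rw [norm_div, div_le_iff₀ (norm_pos_iff.2 (sub_ne_zero.2 (h i j hij)))]
  exact hu j hij

variable {v : Fin n → ℝ} {s b : ℝ} {x : Fin n → K}

theorem IsApprox.rate_lt (h : IsApprox v s b x ξ) : b + 2 * (s * (1 + b)) < 1 := by
  linarith [h.lt_two]

theorem IsApprox.rate_lt_one (h : IsApprox v s b x ξ) : b < 1 := by
  have := h.rate_nonneg
  have := h.scale_nonneg
  nlinarith [h.rate_lt, mul_nonneg h.scale_nonneg h.rate_nonneg]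

theorem IsApprox.scale_lt_half (h : IsApprox v s b x ξ) : s < 1 / 2 := by
  nlinarith [h.rate_lt, mul_nonneg h.scale_nonneg h.rate_nonneg, h.rate_nonneg]

theorem IsApprox.norm_sub_pos (h : IsApprox v s b x ξ) {i j : Fin n} (hij : i ≠ j) :
    0 < ‖x i - x j‖ := norm_pos_iff.2 (sub_ne_zero.2 (h.injective.ne hij))

theorem IsApprox.norm_sub_le (h : IsApprox v s b x ξ) {i j : Fin n} (hij : i ≠ j) :
    ‖x i - ξ i‖ ≤ s * ‖x i - x j‖ :=
  (h.close i j hij).trans (by gcongr; exact h.le i)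

/-- The iterates stay away from the components of `x`. -/
theorem IsApprox.iterFun_bounds (h : IsApprox v s b x ξ) (hf0 : f ≠ 0)
    (hξ : ∀ z, f.eval z = f.leadingCoeff * ∏ i, (z - ξ i)) (M : ℕ) :
    (∀ i j, i ≠ j → ‖x i - x j‖ ≤ 2 * ‖x i - iterFun f M x j‖ ∧
      ‖iterFun f M x j - ξ j‖ ≤ v j * ‖x i - iterFun f M x j‖) ∧
    ∀ i, ‖iterFun f (M + 1) x i - ξ i‖ ≤ b * ‖x i - ξ i‖ := by
  have hstep : ∀ M, (∀ i j, i ≠ j → ‖x i - x j‖ ≤ 2 * ‖x i - iterFun f M x j‖ ∧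
      ‖iterFun f M x j - ξ j‖ ≤ v j * ‖x i - iterFun f M x j‖) →
      ∀ i, ‖iterFun f (M + 1) x i - ξ i‖ ≤ b * ‖x i - ξ i‖ := by
    intro M hM i
    have hsharp : Sharp x (iterFun f M x) := fun i j hij => by
      have := (h.norm_sub_pos hij).trans_le (hM i j hij).1
      exact sub_ne_zero.1 (norm_pos_iff.1 (by linarith))
    refine (norm_iterFun_succ_sub_le hf0 hξ hsharp i fun j hij => (hM i j hij).2).trans ?_
    rw [mul_comm b]
    gcongr
    linarith [h.prod_le i]
  induction M with
  | zero =>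
    have h0 : ∀ i j, i ≠ j → ‖x i - x j‖ ≤ 2 * ‖x i - iterFun f 0 x j‖ ∧
        ‖iterFun f 0 x j - ξ j‖ ≤ v j * ‖x i - iterFun f 0 x j‖ := by
      intro i j hij
      simp only [iterFun]
      refine ⟨by linarith [norm_nonneg (x i - x j)], ?_⟩
      rw [norm_sub_rev (x i)]
      exact h.close j i hij.symm
    exact ⟨h0, hstep 0 h0⟩
  | succ M ih =>
    have h1 : ∀ i j, i ≠ j → ‖x i - x j‖ ≤ 2 * ‖x i - iterFun f (M + 1) x j‖ ∧
        ‖iterFun f (M + 1) x j - ξ j‖ ≤ v j * ‖x i - iterFun f (M + 1) x j‖ := by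
      intro i j hij
      have hD := h.norm_sub_pos hij
      have hb0 := h.rate_nonneg
      have hc : ‖x j - ξ j‖ ≤ v j * ‖x i - x j‖ := by
        rw [norm_sub_rev (x i)]; exact h.close j i hij.symm
      have hs : ‖x j - ξ j‖ ≤ s * ‖x i - x j‖ := by
        rw [norm_sub_rev (x i)]; exact h.norm_sub_le hij.symm
      have hT := ih.2 j
      have htri : ‖x i - x j‖ ≤ ‖x i - iterFun f (M + 1) x j‖ +
          (‖x j - ξ j‖ + ‖iterFun f (M + 1) x j - ξ j‖) := by
        have e : x i - x j = (x i - iterFun f (M + 1) x j) -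
            ((x j - ξ j) - (iterFun f (M + 1) x j - ξ j)) := by ring
        rw [e]
        exact (_root_.norm_sub_le _ _).trans (by gcongr; exact _root_.norm_sub_le _ _)
      have hlow : (1 - s * (1 + b)) * ‖x i - x j‖ ≤ ‖x i - iterFun f (M + 1) x j‖ := by
        nlinarith [mul_le_mul_of_nonneg_left hs hb0]
      have hrate := h.rate_lt
      refine ⟨by nlinarith, ?_⟩
      have hs0 : 0 ≤ s * (1 + b) := mul_nonneg h.scale_nonneg (by linarith)
      calc _ ≤ b * ‖x j - ξ j‖ := hT
        _ ≤ b * (v j * ‖x i - x j‖) := by gcongr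
        _ = v j * (b * ‖x i - x j‖) := by ring
        -- `b ≤ 1 - s(1 + b)` follows from `rate_lt`; so the relative error, now measured against
        -- the new distance, is still at most `v j`.
        _ ≤ v j * ((1 - s * (1 + b)) * ‖x i - x j‖) := by
            gcongr
            · exact h.nonneg j
            · linarith
        _ ≤ _ := by gcongr; exact h.nonneg j
    exact ⟨h1, hstep _ h1⟩

theorem IsApprox.sharp (h : IsApprox v s b x ξ) (hf0 : f ≠ 0)
    (hξ : ∀ z, f.eval z = f.leadingCoeff * ∏ i, (z - ξ i)) (M : ℕ) :
    Sharp x (iterFun f M x) := fun i j hij => by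
  have := (h.norm_sub_pos hij).trans_le ((h.iterFun_bounds hf0 hξ M).1 i j hij).1
  exact sub_ne_zero.1 (norm_pos_iff.1 (by linarith))

theorem IsApprox.mem_iterDomain (h : IsApprox v s b x ξ) (hf0 : f ≠ 0)
    (hξ : ∀ z, f.eval z = f.leadingCoeff * ∏ i, (z - ξ i)) (M : ℕ) :
    x ∈ iterDomain f M := by
  induction M with
  | zero => trivial
  | succ M ih => exact ⟨ih, h.sharp hf0 hξ M⟩

/-- Errors shrink by the factor `b`, distances between components by no less than `1 - 2s(1 + b)`,
and `rate_lt` makes the latter exceed `b`. Hence relative errors do not grow and the same data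
remain valid. -/
theorem IsApprox.iterFun (h : IsApprox v s b x ξ) (hf0 : f ≠ 0)
    (hξ : ∀ z, f.eval z = f.leadingCoeff * ∏ i, (z - ξ i)) {N : ℕ} (hN : 1 ≤ N) :
    IsApprox v s b (iterFun f N x) ξ ∧
      ∀ i, ‖WeierstrassType.iterFun f N x i - ξ i‖ ≤ b * ‖x i - ξ i‖ := by
  obtain ⟨M, rfl⟩ : ∃ M, N = M + 1 := ⟨N - 1, by omega⟩
  have hT := (h.iterFun_bounds hf0 hξ M).2
  refine ⟨?_, hT⟩
  set T := WeierstrassType.iterFun f (M + 1) x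
  have hb0 := h.rate_nonneg
  have hlow : ∀ i j, i ≠ j → b * ‖x i - x j‖ ≤ ‖T i - T j‖ ∧ 0 < ‖T i - T j‖ := by
    intro i j hij
    have hD := h.norm_sub_pos hij
    have hi : ‖x i - ξ i‖ ≤ s * ‖x i - x j‖ := h.norm_sub_le hij
    have hj : ‖x j - ξ j‖ ≤ s * ‖x i - x j‖ := by
      rw [norm_sub_rev (x i)]; exact h.norm_sub_le hij.symm
    have htri : ‖x i - x j‖ ≤ ‖T i - T j‖ + ((‖x i - ξ i‖ + ‖T i - ξ i‖) +
        (‖x j - ξ j‖ + ‖T j - ξ j‖)) := by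
      have e : x i - x j = (T i - T j) + (((x i - ξ i) - (T i - ξ i)) -
          ((x j - ξ j) - (T j - ξ j))) := by ring
      rw [e]
      refine (norm_add_le _ _).trans ?_
      gcongr
      exact (_root_.norm_sub_le _ _).trans
        (add_le_add (_root_.norm_sub_le _ _) (_root_.norm_sub_le _ _))
    have hlow : (1 - 2 * (s * (1 + b))) * ‖x i - x j‖ ≤ ‖T i - T j‖ := by
      nlinarith [mul_le_mul_of_nonneg_left hi hb0, mul_le_mul_of_nonneg_left hj hb0, hT i, hT j]
    have hrate := h.rate_lt
    constructor <;> nlinarith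
  refine ⟨fun i j hij => ?_, h.nonneg, h.le, h.prod_le, h.scale_nonneg, hb0, h.lt_two, ?_⟩
  · by_contra hne
    have := (hlow i j hne).2
    rw [hij, sub_self, norm_zero] at this
    exact lt_irrefl _ this
  · intro i j hij
    calc ‖T i - ξ i‖ ≤ b * ‖x i - ξ i‖ := hT i
      _ ≤ b * (v i * ‖x i - x j‖) := by gcongr; exact h.close i j hij
      _ = v i * (b * ‖x i - x j‖) := by ring
      _ ≤ _ := by gcongr; exacts [h.nonneg i, (hlow i j hij).1]

theorem IsApprox.iterSeq (h : IsApprox v s b x ξ) (hf0 : f ≠ 0)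
    (hξ : ∀ z, f.eval z = f.leadingCoeff * ∏ i, (z - ξ i)) {N : ℕ} (hN : 1 ≤ N) (k : ℕ) :
    IsApprox v s b (iterSeq f N x k) ξ ∧
      ∀ i, ‖WeierstrassType.iterSeq f N x k i - ξ i‖ ≤ b ^ k * ‖x i - ξ i‖ := by
  induction k with
  | zero => exact ⟨h, fun i => by simp [WeierstrassType.iterSeq]⟩
  | succ k ih =>
    obtain ⟨h1, h2⟩ := ih.1.iterFun hf0 hξ hN
    refine ⟨h1, fun i => ?_⟩
    calc _ ≤ b * ‖WeierstrassType.iterSeq f N x k i - ξ i‖ := h2 i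
      _ ≤ b * (b ^ k * ‖x i - ξ i‖) := by gcongr; exacts [h.rate_nonneg, ih.2 i]
      _ = _ := by ring

theorem IsApprox.tendsto_iterSeq (h : IsApprox v s b x ξ) (hf0 : f ≠ 0)
    (hξ : ∀ z, f.eval z = f.leadingCoeff * ∏ i, (z - ξ i)) {N : ℕ} (hN : 1 ≤ N) :
    Tendsto (WeierstrassType.iterSeq f N x) atTop (𝓝 ξ) := by
  rw [tendsto_pi_nhds]
  intro i
  rw [tendsto_iff_norm_sub_tendsto_zero]
  refine squeeze_zero (fun _ => norm_nonneg _) (fun k => (h.iterSeq hf0 hξ hN k).2 i) ?_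
  simpa using (tendsto_pow_atTop_nhds_zero_of_lt_one h.rate_nonneg h.rate_lt_one).mul_const
    ‖x i - ξ i‖

theorem IsApprox.injective_roots (h : IsApprox v s b x ξ) : Function.Injective ξ := by
  intro i j hij
  by_contra hne
  have hD := h.norm_sub_pos hne
  have h1 := h.norm_sub_le hne
  have h2 := h.norm_sub_le (Ne.symm hne)
  rw [norm_sub_rev (x j) (x i), ← hij] at h2
  have h3 : ‖x i - x j‖ ≤ ‖x i - ξ i‖ + ‖x j - ξ i‖ := by
    have := _root_.norm_sub_le (x i - ξ i) (x j - ξ i)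
    rwa [sub_sub_sub_cancel_right] at this
  nlinarith [h.scale_lt_half]

theorem IsApprox.norm_roots_sub_le (h : IsApprox v s b x ξ) {i j : Fin n} (hij : i ≠ j) :
    ‖ξ i - ξ j‖ ≤ 2 * ‖x i - x j‖ := by
  have h1 := h.norm_sub_le hij
  have h2 := h.norm_sub_le hij.symm
  rw [norm_sub_rev (x j) (x i)] at h2
  have h3 : ‖ξ i - ξ j‖ ≤ ‖x i - x j‖ + (‖x i - ξ i‖ + ‖x j - ξ j‖) := by
    have e : ξ i - ξ j = (x i - x j) - ((x i - ξ i) - (x j - ξ j)) := by ring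
    rw [e]
    exact (_root_.norm_sub_le _ _).trans (by gcongr; exact _root_.norm_sub_le _ _)
  nlinarith [h.scale_lt_half, h.norm_sub_pos hij]

/-- One more inner iteration raises the order by one. -/
theorem IsApprox.pNorm_iterFun_sub_le (h : IsApprox v s b x ξ) (hf0 : f ≠ 0)
    (hξ : ∀ z, f.eval z = f.leadingCoeff * ∏ i, (z - ξ i)) {p : ℝ≥0∞} (hp : 1 ≤ p) {δ : ℝ}
    (hδ0 : 0 < δ) (hδ : ∀ i j, i ≠ j → δ ≤ ‖ξ i - ξ j‖) (N : ℕ) :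
    pNorm p (WeierstrassType.iterFun f N x - ξ) ≤
      (2 ^ (n - 1) * (4 / δ)) ^ N * pNorm p (x - ξ) ^ (N + 1) := by
  induction N with
  | zero => simp [WeierstrassType.iterFun]
  | succ N ih =>
    have hP := pNorm_nonneg hp (WeierstrassType.iterFun f N x - ξ)
    have hP0 := pNorm_nonneg hp (x - ξ)
    set P := pNorm p (WeierstrassType.iterFun f N x - ξ) with hPdef
    set L : ℝ := 2 ^ (n - 1) * (4 / δ) with hL
    have hL0 : 0 ≤ L := by positivity
    have hr0 : 0 ≤ min 1 (4 / δ * P) := le_min zero_le_one (by positivity)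
    have hcomp : ∀ i, ‖(WeierstrassType.iterFun f (N + 1) x - ξ) i‖ ≤ L * P * ‖(x - ξ) i‖ := by
      intro i
      -- The cap at `1` permits the chord bound; the other entry is linear in `P`. The `4` comes
      -- from `δ ≤ |ξ_i - ξ_j| ≤ 2 |x_i - x_j| ≤ 4 |x_i - T_j|`. Nothing here depends on `x` except
      -- through the errors, so one constant serves for all `k`.
      have hu := norm_iterFun_succ_sub_le hf0 hξ (h.sharp hf0 hξ N) i
        (u := fun _ => min 1 (4 / δ * P)) fun j hij => by
          obtain ⟨h1, h2⟩ := (h.iterFun_bounds hf0 hξ N).1 i j hij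
          have hD := h.norm_sub_pos hij
          rw [min_mul_of_nonneg _ _ (norm_nonneg _)]
          refine le_min (h2.trans ?_) ?_
          · gcongr
            linarith [h.le j, h.scale_lt_half]
          · have h3 : ‖WeierstrassType.iterFun f N x j - ξ j‖ ≤ P :=
              norm_apply_le_pNorm hp (WeierstrassType.iterFun f N x - ξ) j
            have h4 : δ ≤ 4 * ‖x i - WeierstrassType.iterFun f N x j‖ := by
              linarith [hδ i j hij, h.norm_roots_sub_le hij]
            refine h3.trans ?_
            rw [div_mul_eq_mul_div, div_mul_eq_mul_div, le_div_iff₀ hδ0]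
            nlinarith [mul_le_mul_of_nonneg_left h4 hP]
      rw [Finset.prod_const, Finset.card_erase_of_mem (Finset.mem_univ i), Finset.card_univ,
        Fintype.card_fin] at hu
      refine hu.trans ?_
      rw [mul_comm]
      refine mul_le_mul_of_nonneg_right ?_ (norm_nonneg _)
      calc (1 + min 1 (4 / δ * P)) ^ (n - 1) - 1
          ≤ (2 ^ (n - 1) - 1) * min 1 (4 / δ * P) := by
            linarith [one_add_pow_le_of_le_one hr0 (min_le_left _ _) (n - 1)]
        _ ≤ 2 ^ (n - 1) * (4 / δ * P) := by
            gcongr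
            · linarith
            · exact min_le_right _ _
        _ = _ := by rw [hL]; ring
    calc _ ≤ L * P * pNorm p (x - ξ) := pNorm_le_mul_pNorm hp _ _ (by positivity) hcomp
      _ ≤ L * (L ^ N * pNorm p (x - ξ) ^ (N + 1)) * pNorm p (x - ξ) := by gcongr
      _ = _ := by ring

theorem exists_pos_le_norm_sub (hξ : Function.Injective ξ) :
    ∃ δ : ℝ, 0 < δ ∧ ∀ i j, i ≠ j → δ ≤ ‖ξ i - ξ j‖ := by
  have h0 : ∀ ij ∈ (Finset.univ : Finset (Fin n × Fin n)), 0 ≤ ‖ξ ij.1 - ξ ij.2‖⁻¹ :=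
    fun _ _ => inv_nonneg.2 (norm_nonneg _)
  have hS := Finset.sum_nonneg h0
  -- Diagonal terms are `0⁻¹ = 0`, and the `1 +` keeps the sum positive when there are no distinct
  -- pairs.
  refine ⟨(1 + ∑ ij : Fin n × Fin n, ‖ξ ij.1 - ξ ij.2‖⁻¹)⁻¹, by positivity, fun i j hij => ?_⟩
  refine inv_le_of_inv_le₀ (norm_pos_iff.2 (sub_ne_zero.2 (hξ.ne hij))) ?_
  linarith [Finset.single_le_sum h0 (Finset.mem_univ (i, j))]

theorem IsApprox.convergesWithOrder (h : IsApprox v s b x ξ) (hf0 : f ≠ 0)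
    (hξ : ∀ z, f.eval z = f.leadingCoeff * ∏ i, (z - ξ i)) {p : ℝ≥0∞} (hp : 1 ≤ p) {N : ℕ}
    (hN : 1 ≤ N) : ConvergesWithOrder p (N + 1) (WeierstrassType.iterSeq f N x) ξ := by
  obtain ⟨δ, hδ0, hδ⟩ := exists_pos_le_norm_sub h.injective_roots
  exact ⟨h.tendsto_iterSeq hf0 hξ hN, _, by positivity, fun k =>
    (h.iterSeq hf0 hξ hN k).1.pNorm_iterFun_sub_le hf0 hξ hp hδ0 hδ N⟩

end Local

theorem iterSeq_add (f : K[X]) (N : ℕ) (x : Fin n → K) (k l : ℕ) :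
    iterSeq f N x (l + k) = iterSeq f N (iterSeq f N x k) l := by
  induction l with
  | zero => simp [iterSeq]
  | succ l ih => rw [Nat.add_right_comm, iterSeq, ih, iterSeq]

theorem eval_eq_of_isRoot {f : K[X]} (hf : f.natDegree = n) (hf0 : f ≠ 0)
    {ξ : Fin n → K} (hξ : Function.Injective ξ) (h : ∀ i, f.IsRoot (ξ i)) (z : K) :
    f.eval z = f.leadingCoeff * ∏ i, (z - ξ i) := by
  conv_lhs => rw [eq_C_mul_prod_of_isRoot hf hf0 hξ h]
  rw [Polynomial.eval_mul, Polynomial.eval_prod]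
  simp

end WeierstrassType

end

theorem mainTheorem6 {K : Type*} [NormedField K] [IsAlgClosed K]
    (n : ℕ) (hn : 2 ≤ n) (f : K[X]) (hf : f.natDegree = n)
    (N : ℕ) (hN : 1 ≤ N)
    (p q : ℝ≥0∞) (hpq : ENNReal.HolderConjugate p q)
    (x₀ : Fin n → K) (hx₀ : Function.Injective x₀)
    (hE : WeierstrassType.initFun p f x₀ ≤ 2 / (5 * WeierstrassType.aConst n q + 6)) :
    WeierstrassType.OnlySimpleZeros f ∧
    WeierstrassType.IterWellDefined f N x₀ ∧
    ∃ ξ : Fin n → K,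
      WeierstrassType.IsRootVector f ξ ∧
      WeierstrassType.ConvergesWithOrder p (N + 1) (WeierstrassType.iterSeq f N x₀) ξ ∧
      ∀ k : ℕ,
        WeierstrassType.initFun p f (WeierstrassType.iterSeq f N x₀ k) ≤
            1 / (1 + √(WeierstrassType.aConst n q)) ^ 2 →
        WeierstrassType.Omega n p q
            (WeierstrassType.initFun p f (WeierstrassType.iterSeq f N x₀ k)) < 2 →
        ∀ i : Fin n,
          ‖WeierstrassType.iterSeq f N x₀ k i - ξ i‖ ≤
            WeierstrassType.alpha (WeierstrassType.aConst n q)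
                (WeierstrassType.initFun p f (WeierstrassType.iterSeq f N x₀ k)) *
              ‖WeierstrassType.correction f (WeierstrassType.iterSeq f N x₀ k) i‖ := by
  have hf0 : f ≠ 0 := by rintro rfl; simp at hf; omega
  have hp1 : 1 ≤ p := ENNReal.HolderConjugate.one_le p q
  obtain ⟨ξ, v, s, b, hξ, hroot, happ, -⟩ :=
    WeierstrassType.exists_roots_of_initFun_le hn hf hpq hx₀
      (hE.trans (WeierstrassType.two_div_le_one_div_sq (WeierstrassType.one_le_aConst hn q)))
      (WeierstrassType.Omega_lt_two hn hpq (WeierstrassType.initFun_nonneg hp1 f x₀) hE)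
  have hev := WeierstrassType.eval_eq_of_isRoot hf hf0 hξ hroot
  refine ⟨WeierstrassType.onlySimpleZeros_of_isRoot hf hf0 hξ hroot,
    fun k => (happ.iterSeq hf0 hev hN k).1.mem_iterDomain hf0 hev N, ξ, ⟨_, hev⟩,
    happ.convergesWithOrder hf0 hev hp1 hN, fun k hk hΩ => ?_⟩
  -- Localization at the `k`-th iterate gives the estimate for a possibly different ordering `η` of
  -- the roots. The iteration restarted there converges to `η`, and it is a tail of the original
  -- sequence, so `η = ξ`.
  obtain ⟨η, v', s', b', hη, hroot', happ', hest⟩ :=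
    WeierstrassType.exists_roots_of_initFun_le hn hf hpq
      (happ.iterSeq hf0 hev hN k).1.injective hk hΩ
  have hlim := happ'.tendsto_iterSeq hf0
    (WeierstrassType.eval_eq_of_isRoot hf hf0 hη hroot') hN
  have hlim' := (tendsto_add_atTop_iff_nat k).2 (happ.tendsto_iterSeq hf0 hev hN)
  simp only [WeierstrassType.iterSeq_add] at hlim'
  rw [tendsto_nhds_unique hlim' hlim]
  exact hest
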